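/- Probability distributions take rational values. A $d$-dimensional Markov decision process (MDP) $\mathcal G$ consists of a finite set of states $S$, an edge relation $E\subseteq S\times S$ in which every state has a successor, a weight function $w:E\to\mathbb Z^d$, a partition $S=S^C\cup S^R$ into states of Controller and of Random, and for every $s\in S^R$ a probability distribution $R(s)$ on $S$ whose support is exactly $E(s)=\{t:(s,t)\in E\}$. A play is an infinite path $\pi=s_0s_1\cdots$ of the graph; its mean payoff is the componentwise $\mathrm{MP}(\pi)=\liminf_{n\to\infty}\frac1n\sum_{i<n}w(s_i,s_{i+1})$. A strategy of Controller is a stochastic Moore machine $f=(M,\alpha,f_u,f_o)$ with memory states $M$, initial memory distribution $\alpha$ on $M$, memory updates $f_u(s,m)$, which are distributions on $M$ for $s\in S$, $m\in M$, and outputs $f_o(s,m)$, which are distributions on $S$ supported in $E(s)$ for $s\in S^C$, $m\in M$. It is finite-memory if $M$ is finite. Put $f_u^*(\varepsilon)=\alpha$, $f_u^*(\pi s)(m')=\sum_m f_u^*(\pi)(m)f_u(s,m)(m')$ and $f_o^*(\pi s)(s')=\sum_m f_u^*(\pi)(m)f_o(s,m)(s')$. An outcome of $f$ from $s_0$ is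 a play $s_0s_1\cdots$ such that $f_o^*(s_0\cdots s_i)(s_{i+1})>0$ for all $i$ with $s_i\in S^C$. The strategy $f$ satisfies the worst-case threshold from $s_0$ if $\mathrm{MP}(\pi)>\vec 0$ (in every component) for all outcomes $\pi$ of $f$ from $s_0$. The probability of an event under $f$ from $s_0$ is taken in the Markov chain on $S\times M$ with initial distribution $\delta_{s_0}\times\alpha$ in which $(s,m)$ moves to $(s',m')$ with probability $f_o(s,m)(s')\,f_u(s,m)(m')$ if $s\in S^C$ and $R(s)(s')\,f_u(s,m)(m')$ if $s\in S^R$, projected to sequences of states. An end-component is a non-empty set $U\subseteq S$ such that any two (possibly equal) states of $U$ are joined by a path with at least one edge inside $U$, and $E(s)\subseteq U$ for all $s\in U\cap S^R$. It is winning if for every $s\in U$ Controller has a strategy (with finite or infinite memory) all of whose outcomes from $s$ remain in $U$ and have mean payoff $>\vec 0$ in every component. **Proposition.** Let $\mathcal G$ be an MDP, $s_0$ a state, and $f$ a finite-memory strategy that satisfies the worst-case threshold from $s_0$. Then, almost surely under $f$ from $s_0$, the set of states visited infinitely often is a winning end-component. -/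

import Mathlib

open MeasureTheory ProbabilityTheory Filter
open scoped ENNReal NNReal

noncomputable section

namespace BWC

/-- Probability distributions on `A`: they take rational values and sum up to `1`. -/
def ProbDist (A : Type*) : Type _ :=
  {p : PMF A // ∀ a, ∃ q : ℚ≥0, p a = ((q : ℝ≥0) : ℝ≥0∞)}

/-- A Markov decision process over a `d`-dimensional multi-weighted graph with set of states `S`.
Only the weights `w s t` of pairs with `E s t` are ever used on plays. The states of Random are
those not in `controller`. -/
structure MDP (d : ℕ) (S : Type*) where
  /-- the edge relation -/
  E : S → S → Prop
  /-- the weight vectors of the edges -/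
  w : S → S → Fin d → ℤ
  exists_succ : ∀ s, ∃ t, E s t
  /-- the states of Controller -/
  controller : Set S
  /-- the distributions at the states of Random -/
  R : ↥(controllerᶜ) → ProbDist S
  support_R : ∀ s t, t ∈ (R s).1.support ↔ E s t

/-- A stochastic Moore machine with set of memory states `M`, i.e., a strategy of Controller. -/
structure Strategy {d : ℕ} {S : Type*} (G : MDP d S) (M : Type*) where
  /-- the initial memory distribution -/
  init : ProbDist M
  /-- the stochastic memory update function -/
  upd : S → M → ProbDist M
  /-- the stochastic output function -/
  out : ↥G.controller → M → ProbDist S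
  out_support : ∀ s m t, t ∈ (out s m).1.support → G.E s t

/-- A play is an infinite path of the graph. -/
def MDP.IsPlay {d : ℕ} {S : Type*} (G : MDP d S) (π : ℕ → S) : Prop :=
  ∀ n, G.E (π n) (π (n + 1))

/-- The prefix `π 0, …, π (n - 1)` of length `n`. -/
def pre {S : Type*} (π : ℕ → S) (n : ℕ) : List S := (List.range n).map π

/-- The total payoff up to length `n`, in component `i`. -/
def MDP.totalPayoff {d : ℕ} {S : Type*} (G : MDP d S) (π : ℕ → S) (n : ℕ) (i : Fin d) : ℤ :=
  ∑ k ∈ Finset.range n, G.w (π k) (π (k + 1)) i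

/-- The (lim-inf) mean payoff, in component `i`. -/
def MDP.meanPayoff {d : ℕ} {S : Type*} (G : MDP d S) (π : ℕ → S) (i : Fin d) : EReal :=
  liminf (fun n : ℕ => (((G.totalPayoff π n i : ℝ) / (n : ℝ) : ℝ) : EReal)) atTop

namespace Strategy

variable {d : ℕ} {S : Type*} {G : MDP d S} {M : Type*}

/-- The memory update function extended to finite sequences of states:
`updStar [] = init`, `updStar (π s) m' = ∑ m, updStar π m * upd s m m'`. -/
def updStar (f : Strategy G M) (l : List S) : PMF M :=
  l.foldl (fun p s => p.bind fun m => (f.upd s m).1) f.init.1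

/-- The output function extended to finite sequences of states that end in a state of Controller:
`outStar π s s' = ∑ m, updStar π m * out s m s'`. -/
def outStar (f : Strategy G M) (l : List S) (s : ↥G.controller) : PMF S :=
  (f.updStar l).bind fun m => (f.out s m).1

/-- The play `π` is consistent with the strategy `f`. -/
def Consistent (f : Strategy G M) (π : ℕ → S) : Prop :=
  ∀ i (h : π i ∈ G.controller), π (i + 1) ∈ (f.outStar (pre π i) ⟨π i, h⟩).support

/-- The plays from `s₀` that are consistent with `f`. -/
def outcomes (f : Strategy G M) (s₀ : S) : Set (ℕ → S) :=
  {π | π 0 = s₀ ∧ G.IsPlay π ∧ f.Consistent π}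

/-- From `s₀`, the strategy `f` surely guarantees a mean payoff `> 0` in every component. -/
def SatisfiesWorstCase (f : Strategy G M) (s₀ : S) : Prop :=
  ∀ π ∈ f.outcomes s₀, ∀ i, 0 < G.meanPayoff π i

open Classical in
/-- The distribution of the next state of the MDP from state `s` and memory `m`. -/
def next (f : Strategy G M) (s : S) (m : M) : PMF S :=
  if h : s ∈ G.controller then (f.out ⟨s, h⟩ m).1 else (G.R ⟨s, h⟩).1

/-- The transition probabilities of the induced Markov chain `G[f]` on `S × M`:
`(s, m)` moves to `(s', m')` with probability `next s m s' * upd s m m'`. -/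
def chainStep (f : Strategy G M) (x : S × M) : PMF (S × M) :=
  (f.next x.1 x.2).bind fun s' => (f.upd x.1 x.2).1.map fun m' => (s', m')

/-- The initial distribution of the induced Markov chain: state `s₀` and random initial memory. -/
def chainInit (f : Strategy G M) (s₀ : S) : PMF (S × M) :=
  f.init.1.map fun m => (s₀, m)

end Strategy

section Chain

variable {X : Type*} [Countable X] [MeasurableSpace X] [DiscreteMeasurableSpace X]

/-- The transition kernel that at time `n` draws the next state from `P` applied to the
state at time `n`. -/
def stepKernel (P : X → PMF X) (n : ℕ) :
    Kernel ((_ : Finset.Iic n) → X) X where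
  toFun h := (P (h ⟨n, Finset.mem_Iic.2 le_rfl⟩)).toMeasure
  measurable' := Measurable.of_discrete.comp
    (f := fun h : (_ : Finset.Iic n) → X => h ⟨n, Finset.mem_Iic.2 le_rfl⟩)
    (g := fun x => (P x).toMeasure) (measurable_pi_apply _)

instance (P : X → PMF X) (n : ℕ) : IsMarkovKernel (stepKernel P n) :=
  ⟨fun _ => PMF.toMeasure.isProbabilityMeasure _⟩

/-- The law on infinite sequences of the Markov chain with initial distribution `ι` and transition
probabilities `P`, given by the Ionescu-Tulcea theorem. -/
def markovLaw (P : X → PMF X) (ι : PMF X) : Measure (ℕ → X) :=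
  (ι.toMeasure.map fun (x : X) (_ : Finset.Iic 0) => x).bind
    (Kernel.traj (X := fun _ => X) (stepKernel P) 0)

end Chain

/-- The probability measure on sequences of states obtained from starting in `s₀` and playing `f`:
the law of the induced Markov chain, projected to the states of the MDP. -/
def Strategy.playLaw {d : ℕ} {S : Type*} {G : MDP d S} {M : Type*} [Finite S] [Finite M]
    [MeasurableSpace S] [DiscreteMeasurableSpace S]
    [MeasurableSpace M] [DiscreteMeasurableSpace M]
    (f : Strategy G M) (s₀ : S) : Measure (ℕ → S) :=
  (markovLaw f.chainStep (f.chainInit s₀)).map fun ρ n => (ρ n).1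

/-- The set of states visited infinitely often. -/
def infVisited {S : Type*} (π : ℕ → S) : Set S := {s | ∃ᶠ n in atTop, π n = s}

/-- End-components: non-empty sets of states whose induced sub-graph is strongly connected
(any two states, equal or not, are joined by a path with at least one edge) and that contain all
successors of their Random states. -/
structure MDP.IsEndComponent {d : ℕ} {S : Type*} (G : MDP d S) (U : Set S) : Prop where
  nonempty : U.Nonempty
  connected : ∀ s ∈ U, ∀ t ∈ U, Relation.TransGen (fun a b => a ∈ U ∧ b ∈ U ∧ G.E a b) s t
  closed : ∀ s ∈ U, s ∉ G.controller → ∀ t, G.E s t → t ∈ U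

/-- Winning end-components: from any of its states, Controller has a strategy (with finite or
infinite memory) that surely remains inside `U` and surely guarantees a mean payoff `> 0` in every
component. Memory states in `Type` are no restriction, since only countably many of them can ever
have positive probability. -/
def MDP.IsWinningEndComponent {d : ℕ} {S : Type*} (G : MDP d S) (U : Set S) : Prop :=
  G.IsEndComponent U ∧
    ∀ s ∈ U, ∃ (M : Type) (f : Strategy G M),
      (∀ π ∈ f.outcomes s, ∀ n, π n ∈ U) ∧ f.SatisfiesWorstCase s

end BWC

end

namespace BWC

/-! ### Almost sure behaviour of a Markov chain -/

section Chain

variable {X : Type*} [MeasurableSpace X] [DiscreteMeasurableSpace X]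

/-! Almost every run of the induced chain on `S × M` uses only positive-probability transitions and
visits infinitely often every successor of a pair it visits infinitely often (`ae_markovLaw`). The
rest is deterministic (`isWinningEndComponent_of_run`). Fix such a run `ρ` and let `U` be its set of
infinitely visited states. Closure under successors of pairs makes `U` closed at Random states. For
`s ∈ U`, finite memory yields an `m` with `(s, m)` visited infinitely often; Controller plays a
derandomized `f` from memory `m`. Each outcome lifts to a run from `(s, m)`, whose pairs are all
visited infinitely often by `ρ`, so it stays in `U`. Preceded by a prefix of `ρ` ending in `(s, m)`,
it becomes an outcome of `f` from `s₀`; its mean payoff is positive, and dropping the prefix keeps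
it so. -/

theorem ae_mem_support (p : PMF X) : ∀ᵐ x ∂p.toMeasure, x ∈ p.support := by
  rw [ae_iff]
  exact (PMF.toMeasure_apply_eq_zero_iff _ .of_discrete).2
    (Set.disjoint_left.2 fun _ hx hx' => hx' hx)

theorem traj_map_succ (P : X → PMF X) (n : ℕ) (h : (_ : Finset.Iic n) → X) :
    (Kernel.traj (X := fun _ => X) (stepKernel P) n h).map (fun ρ => ρ (n + 1)) =
      (P (h ⟨n, Finset.mem_Iic.2 le_rfl⟩)).toMeasure := by
  rw [← Kernel.map_apply _ (by fun_prop), Kernel.map_traj_succ_self]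
  rfl

variable [Countable X]

theorem ae_traj_frestrictLe_eq (P : X → PMF X) (n : ℕ) (h : (_ : Finset.Iic n) → X) :
    ∀ᵐ ρ ∂(Kernel.traj (X := fun _ => X) (stepKernel P) n h),
      Preorder.frestrictLe (π := fun _ => X) n ρ = h := by
  apply ae_of_ae_map (f := Preorder.frestrictLe (π := fun _ => X) n)
    (p := fun x => x = h) (by fun_prop)
  rw [Kernel.traj_map_frestrictLe_apply, Kernel.partialTraj_self, Kernel.id_apply]
  exact (ae_dirac_iff (measurableSet_singleton h)).2 rfl

theorem measurableSet_step (P : X → PMF X) (n : ℕ) :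
    MeasurableSet {ρ : ℕ → X | ρ (n + 1) ∈ (P (ρ n)).support} := by
  have hm : Measurable fun ρ : ℕ → X => (ρ n, ρ (n + 1)) := by fun_prop
  exact hm (MeasurableSet.of_discrete (s := {x : X × X | x.2 ∈ (P x.1).support}))

theorem ae_traj_step (P : X → PMF X) (h : (_ : Finset.Iic 0) → X) (n : ℕ) :
    ∀ᵐ ρ ∂(Kernel.traj (X := fun _ => X) (stepKernel P) 0 h), ρ (n + 1) ∈ (P (ρ n)).support := by
  -- Condition on the history up to time `n`, which determines the law of the next state.
  rw [← Kernel.traj_comp_partialTraj (Nat.zero_le n), ae_iff, ← Set.compl_ofPred,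
    Kernel.comp_apply' _ _ _ (measurableSet_step P n).compl]
  refine (lintegral_congr fun g => ?_).trans lintegral_zero
  rw [Set.compl_ofPred, ← ae_iff]
  have hs : ∀ᵐ ρ ∂(Kernel.traj (X := fun _ => X) (stepKernel P) n g),
      ρ (n + 1) ∈ (P (g ⟨n, Finset.mem_Iic.2 le_rfl⟩)).support := by
    apply ae_of_ae_map (f := fun ρ : ℕ → X => ρ (n + 1))
      (measurable_pi_apply _).aemeasurable
      (p := fun x => x ∈ (P (g ⟨n, Finset.mem_Iic.2 le_rfl⟩)).support)
    rw [traj_map_succ]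
    exact ae_mem_support _
  filter_upwards [hs, ae_traj_frestrictLe_eq P n g] with ρ h₁ h₂
  rw [← h₂] at h₁
  exact h₁

theorem measurableSet_apply_eq (n : ℕ) (y : X) : MeasurableSet {ρ : ℕ → X | ρ n = y} :=
  measurableSet_preimage (measurable_pi_apply (X := fun _ : ℕ => X) n) (measurableSet_singleton y)

theorem measurableSet_frequently_apply_eq (x : X) :
    MeasurableSet {ρ : ℕ → X | ∃ᶠ n in atTop, ρ n = x} := by
  simp only [frequently_atTop, Set.ofPred_forall, Set.ofPred_exists]
  exact .iInter fun a => .iUnion fun b => .inter (.const _) (measurableSet_apply_eq b x)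

theorem condExp_traj_succ (P : X → PMF X) (h : (_ : Finset.Iic 0) → X) (n : ℕ) (y : X) :
    (Kernel.traj (X := fun _ => X) (stepKernel P) 0 h)[
        {ρ : ℕ → X | ρ (n + 1) = y}.indicator (1 : (ℕ → X) → ℝ) |
        Filtration.piLE (X := fun _ => X) n]
      =ᵐ[Kernel.traj (X := fun _ => X) (stepKernel P) 0 h]
      fun ρ => (P (ρ n) y).toReal := by
  have hm := measurableSet_apply_eq (n + 1) y
  refine (Kernel.condExp_traj (Nat.zero_le n)
    ((integrable_const (1 : ℝ)).indicator hm)).trans (.of_forall fun ρ => ?_)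
  refine (integral_indicator_one hm).trans ?_
  have := congrArg (fun μ : Measure X => μ {y}) (traj_map_succ P n (Preorder.frestrictLe n ρ))
  rw [Measure.map_apply (by fun_prop) (measurableSet_singleton y),
    PMF.toMeasure_apply_singleton _ _ (measurableSet_singleton y)] at this
  exact congrArg ENNReal.toReal this

/-- Lévy's conditional Borel–Cantelli lemma: each visit to `x` adds the same positive `P x y` to the
sum of conditional probabilities of moving to `y`, so this sum diverges. -/
theorem ae_traj_frequently (P : X → PMF X) (h : (_ : Finset.Iic 0) → X) (x y : X)
    (hxy : y ∈ (P x).support) :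
    ∀ᵐ ρ ∂(Kernel.traj (X := fun _ => X) (stepKernel P) 0 h),
      (∃ᶠ n in atTop, ρ n = x) → ∃ᶠ n in atTop, ρ n = y := by
  have hs : ∀ n, MeasurableSet[Filtration.piLE (X := fun _ : ℕ => X) n] {ρ : ℕ → X | ρ n = y} :=
    fun n => ⟨(fun g => g ⟨n, Set.mem_Iic.2 le_rfl⟩) ⁻¹' {y},
      (measurable_pi_apply (⟨n, Set.mem_Iic.2 le_rfl⟩ : Set.Iic n)) (measurableSet_singleton y), rfl⟩
  filter_upwards [ae_mem_limsup_atTop_iff (Kernel.traj (X := fun _ => X) (stepKernel P) 0 h) hs,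
    ae_all_iff.2 fun n => condExp_traj_succ P h n y] with ρ h₁ h₂ hx
  suffices hy : ρ ∈ limsup (fun n => {ρ : ℕ → X | ρ n = y}) atTop from
    mem_limsup_iff_frequently_mem (s := fun n => {ρ : ℕ → X | ρ n = y}).1 hy
  rw [h₁]
  simp only [h₂]
  have hp : 0 < (P x y).toReal :=
    ENNReal.toReal_pos ((PMF.mem_support_iff _ _).1 hxy) (PMF.apply_ne_top _ _)
  refine (not_summable_iff_tendsto_nat_atTop_of_nonneg fun _ => ENNReal.toReal_nonneg).1 fun hsum =>
    ?_
  have := (hsum.tendsto_atTop_zero.eventually_lt_const hp)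
  obtain ⟨n, hn, hn'⟩ := (hx.and_eventually this).exists
  rw [hn] at hn'
  exact lt_irrefl _ hn'

theorem ae_markovLaw (P : X → PMF X) (ι : PMF X) :
    ∀ᵐ ρ ∂(markovLaw P ι), ρ 0 ∈ ι.support ∧ (∀ n, ρ (n + 1) ∈ (P (ρ n)).support) ∧
      ∀ x y, y ∈ (P x).support → (∃ᶠ n in atTop, ρ n = x) → ∃ᶠ n in atTop, ρ n = y := by
  have hf := measurableSet_frequently_apply_eq (X := X)
  have hm : MeasurableSet {ρ : ℕ → X | ρ 0 ∈ ι.support ∧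
      (∀ n, ρ (n + 1) ∈ (P (ρ n)).support) ∧
      ∀ x y, y ∈ (P x).support → (∃ᶠ n in atTop, ρ n = x) → ∃ᶠ n in atTop, ρ n = y} := by
    have h₀ : MeasurableSet {ρ : ℕ → X | ρ 0 ∈ ι.support} :=
      measurableSet_preimage (measurable_pi_apply (X := fun _ : ℕ => X) 0)
        (.of_discrete (s := ι.support))
    have h₁ : MeasurableSet {ρ : ℕ → X | ∀ n, ρ (n + 1) ∈ (P (ρ n)).support} := by
      simp only [Set.ofPred_forall]
      exact .iInter fun n => measurableSet_step P n
    have h₂ : MeasurableSet {ρ : ℕ → X | ∀ x y, y ∈ (P x).support →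
        (∃ᶠ n in atTop, ρ n = x) → ∃ᶠ n in atTop, ρ n = y} := by
      simp only [Set.ofPred_forall]
      exact .iInter fun x => .iInter fun y => .iInter fun _ => .imp (hf x) (hf y)
    exact h₀.inter (h₁.inter h₂)
  have hm₀ : Measurable fun (x : X) (_ : Finset.Iic 0) => x := by fun_prop
  rw [ae_iff, markovLaw, ← Set.compl_ofPred, Measure.bind_apply hm.compl (Kernel.aemeasurable _),
    lintegral_map (Kernel.measurable_coe _ hm.compl) hm₀]
  refine (lintegral_congr_ae ?_).trans lintegral_zero
  filter_upwards [ae_mem_support ι] with x hx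
  rw [Set.compl_ofPred, ← ae_iff]
  filter_upwards [ae_traj_frestrictLe_eq P 0 fun _ => x, ae_all_iff.2 (ae_traj_step P fun _ => x),
    ae_all_iff.2 fun y => ae_all_iff.2 fun z => ae_all_iff.2
      (ae_traj_frequently P (fun _ => x) y z)] with ρ h₁ h₂ h₃
  refine ⟨?_, h₂, h₃⟩
  have : ρ 0 = x := congrFun h₁ ⟨0, Finset.mem_Iic.2 le_rfl⟩
  exact this ▸ hx

end Chain

end BWC

/-! ### Mean payoffs, outcomes and runs of the induced chain -/

namespace BWC

/-- The Dirac distribution. -/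
noncomputable def ProbDist.pure {A : Type*} (a : A) : ProbDist A :=
  ⟨PMF.pure a, fun b => by
    classical
    by_cases h : b = a
    · exact ⟨1, by simp [PMF.pure_apply, h]⟩
    · exact ⟨0, by simp [PMF.pure_apply, h]⟩⟩

theorem pre_succ {S : Type*} (π : ℕ → S) (n : ℕ) : pre π (n + 1) = pre π n ++ [π n] := by
  simp [pre, List.range_succ]

variable {d : ℕ} {S : Type*} {G : MDP d S} {M : Type*}

theorem MDP.totalPayoff_add (G : MDP d S) (π : ℕ → S) (k n : ℕ) (i : Fin d) :
    G.totalPayoff π (k + n) i =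
      G.totalPayoff π k i + G.totalPayoff (fun j => π (k + j)) n i := by
  simp only [MDP.totalPayoff, Finset.sum_range_add, add_assoc]

/-- Strict positivity of the mean payoff does not depend on a finite prefix. -/
theorem MDP.meanPayoff_pos_of_shift (G : MDP d S) (π : ℕ → S) (k : ℕ) (i : Fin d)
    (h : 0 < G.meanPayoff π i) : 0 < G.meanPayoff (fun j => π (k + j)) i := by
  obtain ⟨ε, hε, hε'⟩ := EReal.lt_iff_exists_real_btwn.1 h
  have hε₀ : 0 < ε := EReal.coe_pos.1 hε
  have h₁ := eventually_lt_of_lt_liminf hε'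
  refine lt_of_lt_of_le (EReal.coe_pos.2 (half_pos hε₀)) (le_liminf_of_le (by isBoundedDefault) ?_)
  -- For `n ≥ N` the prefix contributes at most `ε * n / 2`, which is the slack left by aiming at `ε
  -- / 2`.
  obtain ⟨N, hN⟩ := exists_nat_gt ((G.totalPayoff π k i : ℝ) * 2 / ε)
  filter_upwards [(tendsto_add_atTop_nat k).eventually h₁, eventually_ge_atTop (N + 1)] with n hn hn'
  rw [EReal.coe_lt_coe_iff, add_comm n k, MDP.totalPayoff_add] at hn
  rw [EReal.coe_le_coe_iff]
  have hn₀ : (0 : ℝ) < n := by exact_mod_cast (by omega : 0 < n)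
  have hNn : (N : ℝ) ≤ n := by exact_mod_cast (by omega : N ≤ n)
  rw [lt_div_iff₀ (Nat.cast_pos.2 (by omega))] at hn
  rw [div_lt_iff₀ hε₀] at hN
  rw [le_div_iff₀ hn₀]
  push_cast at hn
  have : (0 : ℝ) ≤ ε * k := by positivity
  nlinarith

namespace Strategy

theorem updStar_pre_succ (f : Strategy G M) (π : ℕ → S) (n : ℕ) :
    f.updStar (pre π (n + 1)) =
      (f.updStar (pre π n)).bind fun m => (f.upd (π n) m).1 := by
  simp [updStar, pre_succ]

theorem mem_support_chainStep {f : Strategy G M} {x y : S × M} :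
    y ∈ (f.chainStep x).support ↔
      y.1 ∈ (f.next x.1 x.2).support ∧ y.2 ∈ (f.upd x.1 x.2).1.support := by
  simp only [chainStep, PMF.mem_support_bind_iff, PMF.mem_support_map_iff]
  constructor
  · rintro ⟨s, hs, m, hm, rfl⟩
    exact ⟨hs, hm⟩
  · exact fun h => ⟨_, h.1, _, h.2, rfl⟩

theorem next_of_mem (f : Strategy G M) {s : S} (h : s ∈ G.controller) (m : M) :
    f.next s m = (f.out ⟨s, h⟩ m).1 := dif_pos h

theorem next_of_notMem (f : Strategy G M) {s : S} (h : s ∉ G.controller) (m : M) :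
    f.next s m = (G.R ⟨s, h⟩).1 := dif_neg h

theorem edge_of_mem_support_next (f : Strategy G M) {s t : S} {m : M}
    (h : t ∈ (f.next s m).support) : G.E s t := by
  by_cases hs : s ∈ G.controller
  · exact f.out_support ⟨s, hs⟩ m t (f.next_of_mem hs m ▸ h)
  · exact (G.support_R ⟨s, hs⟩ t).1 (f.next_of_notMem hs m ▸ h)

/-- The runs of the induced Markov chain are projected to outcomes. -/
theorem mem_outcomes_of_run (f : Strategy G M) {s₀ : S} {ρ : ℕ → S × M}
    (h₀ : ρ 0 ∈ (f.chainInit s₀).support)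
    (h : ∀ n, ρ (n + 1) ∈ (f.chainStep (ρ n)).support) :
    (fun n => (ρ n).1) ∈ f.outcomes s₀ := by
  simp only [mem_support_chainStep] at h
  obtain ⟨m₀, hm₀, h₀⟩ := (PMF.mem_support_map_iff _ _ _).1 h₀
  -- The memory at time `n` has not yet read the state at time `n`, which `pre` omits too.
  have hupd : ∀ n, (ρ n).2 ∈ (f.updStar (pre (fun n => (ρ n).1) n)).support := by
    intro n
    induction n with
    | zero => rw [← h₀]; exact hm₀
    | succ n ih =>
      rw [updStar_pre_succ, PMF.mem_support_bind_iff]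
      exact ⟨_, ih, (h n).2⟩
  refine ⟨(congrArg Prod.fst h₀).symm, fun n => f.edge_of_mem_support_next (h n).1, fun n hn => ?_⟩
  rw [outStar, PMF.mem_support_bind_iff]
  exact ⟨_, hupd n, f.next_of_mem hn _ ▸ (h n).1⟩

/-- The pure strategy that resolves all random choices of `f`, with memory renamed along `e`. -/
noncomputable def derandomize (f : Strategy G M) {N : Type*} (e : M ≃ N) (m : M) :
    Strategy G N where
  init := .pure (e m)
  upd s n := .pure (e (f.upd s (e.symm n)).1.support_nonempty.some)
  out s n := .pure (f.out s (e.symm n)).1.support_nonempty.some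
  out_support s n t ht := by
    obtain rfl := (PMF.mem_support_pure_iff _ _).1 ht
    exact f.out_support _ _ _ (f.out s (e.symm n)).1.support_nonempty.some_mem

/-- The outcomes of the derandomized strategy are projections of runs of the chain of `f`. -/
theorem exists_run_of_mem_outcomes_derandomize (f : Strategy G M) {N : Type*} (e : M ≃ N)
    {s : S} {m : M} {π : ℕ → S} (hπ : π ∈ (f.derandomize e m).outcomes s) :
    ∃ ρ : ℕ → S × M, ρ 0 = (s, m) ∧ (∀ n, ρ (n + 1) ∈ (f.chainStep (ρ n)).support) ∧
      ∀ n, (ρ n).1 = π n := by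
  obtain ⟨h₀, hplay, hcons⟩ := hπ
  let μ : ℕ → M := fun n => n.rec m fun n m => (f.upd (π n) m).1.support_nonempty.some
  have hμ : ∀ n, (f.derandomize e m).updStar (pre π n) = PMF.pure (e (μ n)) := by
    intro n
    induction n with
    | zero => rfl
    | succ n ih =>
      rw [updStar_pre_succ, ih, PMF.pure_bind]
      simp only [derandomize, ProbDist.pure, e.symm_apply_apply]
      rfl
  refine ⟨fun n => (π n, μ n), Prod.ext h₀ rfl, fun n => mem_support_chainStep.2 ⟨?_, ?_⟩, fun _ => rfl⟩
  · by_cases hn : π n ∈ G.controller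
    · have := hcons n hn
      rw [outStar, hμ, PMF.pure_bind] at this
      simp only [derandomize, ProbDist.pure, e.symm_apply_apply, PMF.mem_support_pure_iff] at this
      change π (n + 1) ∈ (f.next (π n) (μ n)).support
      rw [next_of_mem f hn, this]
      exact (f.out ⟨π n, hn⟩ (μ n)).1.support_nonempty.some_mem
    · change π (n + 1) ∈ (f.next (π n) (μ n)).support
      -- Consistency is void at Random states; here every edge has positive probability.
      rw [next_of_notMem f hn]
      exact (G.support_R ⟨π n, hn⟩ _).2 (hplay n)
  · exact (f.upd (π n) (μ n)).1.support_nonempty.some_mem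

end Strategy

/-! ### States visited infinitely often -/

theorem mem_infVisited_fst [Finite M] {ρ : ℕ → S × M} {s : S} :
    s ∈ infVisited (fun n => (ρ n).1) ↔ ∃ m, ∃ᶠ n in atTop, ρ n = (s, m) := by
  rw [← frequently_exists]
  refine frequently_congr (.of_forall fun n => ?_)
  exact ⟨fun h => ⟨_, Prod.ext h rfl⟩, fun ⟨m, h⟩ => congrArg Prod.fst h⟩

theorem infVisited_nonempty [Finite S] (π : ℕ → S) : (infVisited π).Nonempty := by
  obtain ⟨s, hs⟩ := Finite.exists_infinite_fiber π
  exact ⟨s, Nat.frequently_atTop_iff_infinite.2 (Set.infinite_coe_iff.1 hs)⟩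

theorem eventually_mem_infVisited [Finite S] (π : ℕ → S) : ∀ᶠ n in atTop, π n ∈ infVisited π := by
  have : ∀ s, ∀ᶠ n in atTop, π n = s → s ∈ infVisited π := fun s => by
    by_cases hs : s ∈ infVisited π
    · exact .of_forall fun _ _ => hs
    · exact (not_frequently.1 hs).mono fun n hn hn' => absurd hn' hn
  filter_upwards [eventually_all.2 this] with n hn using hn _ rfl

/-- The states visited infinitely often by a play are strongly connected among themselves. -/
theorem transGen_infVisited [Finite S] {π : ℕ → S} (hπ : G.IsPlay π) {s t : S}
    (hs : s ∈ infVisited π) (ht : t ∈ infVisited π) :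
    Relation.TransGen (fun a b => a ∈ infVisited π ∧ b ∈ infVisited π ∧ G.E a b) s t := by
  obtain ⟨N, hN⟩ := eventually_atTop.1 (eventually_mem_infVisited π)
  obtain ⟨a, ha, rfl⟩ := frequently_atTop.1 hs N
  have hstep : ∀ n ≥ N, π n ∈ infVisited π ∧ π (n + 1) ∈ infVisited π ∧ G.E (π n) (π (n + 1)) :=
    fun n hn => ⟨hN n hn, hN _ (hn.trans n.le_succ), hπ n⟩
  -- A visit strictly after `a` gives a path with at least one edge, even if the two states
  -- coincide.
  obtain ⟨b, hb, rfl⟩ := frequently_atTop.1 ht (a + 1)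
  induction b, hb using Nat.le_induction with
  | base => exact .single (hstep a ha)
  | succ n hn ih =>
    exact (ih (hN n (by omega))).tail (hstep n (by omega))

theorem isWinningEndComponent_of_run [Finite S] [Finite M] (f : Strategy G M) {s₀ : S}
    (hf : f.SatisfiesWorstCase s₀) {ρ : ℕ → S × M}
    (h₀ : ρ 0 ∈ (f.chainInit s₀).support)
    (h : ∀ n, ρ (n + 1) ∈ (f.chainStep (ρ n)).support)
    (hinf : ∀ x y, y ∈ (f.chainStep x).support →
      (∃ᶠ n in atTop, ρ n = x) → ∃ᶠ n in atTop, ρ n = y) :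
    G.IsWinningEndComponent (infVisited fun n => (ρ n).1) := by
  refine ⟨⟨infVisited_nonempty _, fun s hs t ht =>
    transGen_infVisited (f.mem_outcomes_of_run h₀ h).2.1 hs ht, fun s hs hsG t hst => ?_⟩,
    fun s hs => ?_⟩
  · obtain ⟨m, hm⟩ := mem_infVisited_fst.1 hs
    obtain ⟨m', hm'⟩ := (f.upd s m).1.support_nonempty
    refine mem_infVisited_fst.2 ⟨m', hinf (s, m) _ (Strategy.mem_support_chainStep.2 ⟨?_, hm'⟩) hm⟩
    rw [f.next_of_notMem hsG]
    exact (G.support_R ⟨s, hsG⟩ t).2 hst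
  obtain ⟨m, hm⟩ := mem_infVisited_fst.1 hs
  -- Memory is renamed into `Fin` because `M` may live in a higher universe than `Type`.
  refine ⟨Fin (Nat.card M), f.derandomize (Finite.equivFin M) m, fun π hπ n => ?_,
    fun π hπ i => ?_⟩
  all_goals obtain ⟨σ, hσ₀, hσ, hσπ⟩ := f.exists_run_of_mem_outcomes_derandomize _ hπ
  · have hn : ∃ᶠ k in atTop, ρ k = σ n := by
      induction n with
      | zero => rwa [hσ₀]
      | succ n ih => exact hinf _ _ (hσ n) ih
    rw [← hσπ]
    exact mem_infVisited_fst.2 ⟨_, hn⟩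
  · obtain ⟨k, hk⟩ := hm.exists
    -- Splice `σ` onto `ρ` at time `k`, where both are at `(s, m)`: again a run of the chain from
    -- the start.
    let τ : ℕ → S × M := fun n => if n < k then ρ n else σ (n - k)
    have hτk : ∀ n, τ (k + n) = σ n := fun n => by simp [τ]
    have hτ : ∀ n ≤ k, τ n = ρ n := fun n hn => by
      rcases hn.lt_or_eq with hn | rfl
      · simp [τ, hn]
      · simp [τ, hσ₀, hk]
    have hτstep : ∀ n, τ (n + 1) ∈ (f.chainStep (τ n)).support := fun n => by
      rcases lt_or_ge n k with hn | hn
      · rw [hτ n hn.le, hτ (n + 1) hn]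
        exact h n
      · obtain ⟨j, rfl⟩ := Nat.exists_eq_add_of_le hn
        rw [add_assoc, hτk, hτk]
        exact hσ j
    have := G.meanPayoff_pos_of_shift _ k i
      (hf _ (f.mem_outcomes_of_run (hτ 0 (Nat.zero_le k) ▸ h₀) hτstep) i)
    simpa only [hτk, hσπ] using this

theorem measurable_infVisited [Finite S] [MeasurableSpace S] [DiscreteMeasurableSpace S] :
    Measurable (infVisited : (ℕ → S) → Set S) := by
  refine measurable_set_iff.2 fun s => measurableSet_setOfPred.1 ?_
  exact measurableSet_frequently_apply_eq s

end BWC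

theorem mainTheorem11 {d : ℕ} {S : Type*} [Finite S]
    [MeasurableSpace S] [DiscreteMeasurableSpace S]
    (G : BWC.MDP d S) (s₀ : S)
    {M : Type*} [Finite M] [MeasurableSpace M] [DiscreteMeasurableSpace M]
    (f : BWC.Strategy G M) (hf : f.SatisfiesWorstCase s₀) :
    ∀ᵐ π ∂(f.playLaw s₀), G.IsWinningEndComponent (BWC.infVisited π) := by
  have hm : MeasurableSet {π : ℕ → S | G.IsWinningEndComponent (BWC.infVisited π)} :=
    -- Any family of subsets of the finite `S` is finite, hence measurable.
    measurableSet_preimage BWC.measurable_infVisited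
      (Set.toFinite {U | G.IsWinningEndComponent U}).measurableSet
  have hπ : Measurable fun (ρ : ℕ → S × M) n => (ρ n).1 := by fun_prop
  rw [BWC.Strategy.playLaw, ae_map_iff hπ.aemeasurable hm]
  filter_upwards [BWC.ae_markovLaw f.chainStep (f.chainInit s₀)] with ρ ⟨h₀, h, hinf⟩
  exact BWC.isWinningEndComponent_of_run f hf h₀ h hinf
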